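/- There is an absolute constant $K$ such that the following holds. Let $0<\delta\le 1$ be a constant and let $p=p(n)\in[0,1]$ satisfy $np=n^{\delta}$. For a graph $G$ on the vertex set $[n]=\{1,\dots,n\}$ put $T=n^{1-\delta/2-\delta^2/8}$, call the vertices $v\le T$ centers, and let $H=H(G)\subseteq G$ be the subgraph that consists of all edges of $G$ between two centers together with, for every non-center vertex that has a center neighbour in $G$, the edge to its lowest-index center neighbour. A local computation algorithm (LCA) here receives a query $(u,v)\in[n]^2$, makes adaptive probes to $G$ and answers yes or no, using a string of random bits that is shared by all queries and no other memory between queries. The probes are $\mathrm{Exists}(u,v)$ (is $uv$ an edge of $G$?), $\mathrm{Deg}(v)$, and $\mathrm{Nbr}(v,i)$ (the $i$-th entry of the adjacency list of $v$, or $\bot$ if $i>\deg(v)$). It gives access to $H$ if for every query $(u,v)$ and all values of the random bits its answer is yes exactly when $uv\in E(H)$. Then there are LCAs $\mathcal A=\mathcal A_n$ and $\mathcal B=\mathcal B_n$ and a function $f(n)=o(n)$ (all may depend on $\delta$) such that for all sufficiently large $n$ (depending on $\delta$), with probability at least $1-1/n$ over $G\leftarrow G(n,p)$, simultaneously: - $H$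 is a $(2/\delta+5)$-spanner of $G$, that is, $d_H(u,v)\le(2/\delta+5)\,d_G(u,v)$ for all $u,v\in[n]$; - $H$ has at most $n+f(n)$ edges; - $\mathcal A$ gives access to $H$ whenever the adjacency lists of $G$ are sorted in ascending order; - $\mathcal B$ gives access to $H$ for every ordering of the adjacency lists of $G$. Moreover, on every graph $G$ on $[n]$ and every query, the expected number of probes (over the random bits) of $\mathcal A$ is at most $1$ if the adjacency lists are sorted, and for all sufficiently large $n$ the expected number of probes of $\mathcal B$ is at most $K\cdot\min\{n^{\delta},\,n^{1-\delta}\log n\}$ for every ordering of the adjacency lists. -/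

import Mathlib

namespace AvgLCA

/-- An adjacency-list representation of a graph `G` on `[n]`: for every vertex `v`, a list in which
every neighbour of `v` occurs exactly once, in an arbitrary order. -/
structure AdjList {n : ℕ} (G : SimpleGraph (Fin n)) where
  nbrs : Fin n → List (Fin n)
  nodup : ∀ v, (nbrs v).Nodup
  mem_iff : ∀ v w, w ∈ nbrs v ↔ G.Adj v w

/-- The adjacency list of every vertex is in ascending order. -/
def AdjList.Sorted {n : ℕ} {G : SimpleGraph (Fin n)} (L : AdjList G) : Prop :=
  ∀ v, (L.nbrs v).Pairwise (· < ·)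

/-- An adaptive probe strategy that ends in a yes/no answer. The possible probes are
`Exists(u, v)`, `Deg(v)` and `Nbr(v, i)`; the continuation receives the reply to the probe. -/
inductive ProbeTree (n : ℕ) : Type
  | answer (b : Bool) : ProbeTree n
  | probeExists (u v : Fin n) (next : Bool → ProbeTree n) : ProbeTree n
  | probeDeg (v : Fin n) (next : ℕ → ProbeTree n) : ProbeTree n
  | probeNbr (v : Fin n) (i : ℕ) (next : Option (Fin n) → ProbeTree n) : ProbeTree n

namespace ProbeTree

variable {n : ℕ} {G : SimpleGraph (Fin n)}

open Classical in
/-- The answer of the strategy on the graph `G` presented by the adjacency lists `L`.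
`Nbr(v, i)` is counted from `i = 0` and returns `none` if `i` is at least the degree of `v`. -/
noncomputable def output (L : AdjList G) : ProbeTree n → Bool
  | answer b => b
  | probeExists u v next => output L (next (decide (G.Adj u v)))
  | probeDeg v next => output L (next (L.nbrs v).length)
  | probeNbr v i next => output L (next (L.nbrs v)[i]?)

open Classical in
/-- The number of probes that the strategy makes on the graph `G` presented by `L`. -/
noncomputable def probes (L : AdjList G) : ProbeTree n → ℕ
  | answer _ => 0
  | probeExists u v next => probes L (next (decide (G.Adj u v))) + 1
  | probeDeg v next => probes L (next (L.nbrs v).length) + 1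
  | probeNbr v i next => probes L (next (L.nbrs v)[i]?) + 1

end ProbeTree

/-- A local computation algorithm, on graphs with vertex set `[n]`, that answers queries of the form
"is `(u, v)` in `H`?". It has a string of random bits, the same for all queries, and keeps no other
information between queries. -/
structure LCA (n : ℕ) where
  tapeLength : ℕ
  run : (Fin tapeLength → Bool) → Fin n → Fin n → ProbeTree n

namespace LCA

variable {n : ℕ} {G : SimpleGraph (Fin n)}

/-- On the input `G`, presented by `L`, the answers to all queries are those of the graph `H`
(whatever the random bits are). -/
def GivesAccess (A : LCA n) (L : AdjList G) (H : SimpleGraph (Fin n)) : Prop :=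
  ∀ r u v, (A.run r u v).output L = true ↔ H.Adj u v

/-- The expected number of probes, over uniform random bits, for answering the query `(u, v)`. -/
noncomputable def expectedProbes (A : LCA n) (L : AdjList G) (u v : Fin n) : ℝ :=
  (∑ r : Fin A.tapeLength → Bool, ((A.run r u v).probes L : ℝ)) / 2 ^ A.tapeLength

end LCA

/-- `H` is a `k`-spanner of `G`: a subgraph that preserves distances up to the factor `k`
(vertices at finite distance in `G` are at finite distance in `H`). -/
def IsSpanner {V : Type*} (k : ℝ) (G H : SimpleGraph V) : Prop :=
  H ≤ G ∧ ∀ u v, G.Reachable u v → H.Reachable u v ∧ (H.dist u v : ℝ) ≤ k * G.dist u v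

/-- The vertices with identifier at most `T` are centers; the identifiers are `1, …, n`. -/
def IsCenter {n : ℕ} (T : ℝ) (v : Fin n) : Prop := ((v : ℕ) : ℝ) + 1 ≤ T

/-- `v` is the lowest-index center among the neighbours of `u`. -/
def IsLowestCenterNbr {n : ℕ} (G : SimpleGraph (Fin n)) (T : ℝ) (u v : Fin n) : Prop :=
  G.Adj u v ∧ IsCenter T v ∧ ∀ w, G.Adj u w → IsCenter T w → v ≤ w

/-- The subgraph of `G` with all edges between centers, and for every non-center the edge to its
lowest-index center neighbour (if it has a center neighbour). -/
def centerSubgraph {n : ℕ} (G : SimpleGraph (Fin n)) (T : ℝ) : SimpleGraph (Fin n) where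
  Adj u v := (G.Adj u v ∧ IsCenter T u ∧ IsCenter T v) ∨
    (¬ IsCenter T u ∧ IsLowestCenterNbr G T u v) ∨ (¬ IsCenter T v ∧ IsLowestCenterNbr G T v u)
  symm := ⟨fun u v h => by
    rcases h with ⟨h, hu, hv⟩ | h | h
    · exact Or.inl ⟨h.symm, hv, hu⟩
    · exact Or.inr (Or.inr h)
    · exact Or.inr (Or.inl h)⟩
  loopless := ⟨fun u h => by
    rcases h with ⟨h, -⟩ | ⟨-, h, -⟩ | ⟨-, h, -⟩ <;> exact G.loopless.irrefl u h⟩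

end AvgLCA

/-! Write `T = n ^ τ`. Then `p * T = n ^ (δ/2 - δ²/8)` is the order of the number of centers
adjacent to a vertex, and `p * T² = n ^ (1 - δ²/4)` bounds the order of the number of edges between
centers. The latter is `o(n)`, and each vertex adds at most one further edge to its lowest center
neighbour, whence `n + o(n)` edges.

For the stretch, balls inside the center set `C` grow in each step by a factor `lam = n ^ (δ/2 -
δ²/6)`, slightly less than `p * T` so that logarithms are absorbed, until they fill almost half of
`C` (`Expands.lt_card_ballAvoiding`); this takes at most `j = ⌊2/δ⌋ + 2` steps. To reach a
prescribed center `w`, the ball around `u` is grown without looking at the edges at `w`. These edges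
are then still independent of the ball, and one of them hits it with high probability
(`binomialRandom_no_edge_to_set_le`). So centers are within `j + 1` of each other in `H`, and any
two vertices within `j + 3 ≤ 2/δ + 5`.

For the algorithms, centers are an initial segment of the vertices, so the lowest center neighbour
of a vertex is simply its lowest neighbour, if that is a center (`isLowestCenterNbr_iff`). In a
sorted list this is the first entry. In an unsorted list it is found either by reading all of about
`n ^ δ` neighbours or by testing the first `O(n ^ (1-δ) log n)` vertices, among which every
non-center typically has a neighbour. Both scans are truncated, so the probe bounds hold on every
graph, and only correctness needs `Typical`. -/

namespace AvgLCA

open MeasureTheory SimpleGraph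

/-! ### Independence and tail bounds in the binomial random graph. -/

section RandomGraph

variable {V : Type*}

/-- A set of graphs is insensitive to `F` if membership does not depend on the edges in `F`. -/
def Insensitive (F : Set (Sym2 V)) (A : Set (SimpleGraph V)) : Prop :=
  ∀ G G' : SimpleGraph V, (∀ e ∉ F, e ∈ G.edgeSet ↔ e ∈ G'.edgeSet) → G ∈ A → G' ∈ A

lemma Insensitive.mono {F F' : Set (Sym2 V)} {A : Set (SimpleGraph V)} (h : Insensitive F A)
    (hF : F' ⊆ F) : Insensitive F' A :=
  fun G G' hG => h G G' fun e he => hG e fun he' => he (hF he')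

variable [Finite V]

lemma discreteMeasurableSpace_simpleGraph : DiscreteMeasurableSpace (SimpleGraph V) := by
  have : MeasurableSingletonClass (SimpleGraph V) := ⟨fun G => by
    have h : ({G} : Set (SimpleGraph V)) = edgeSet ⁻¹' {G.edgeSet} := by
      ext G'; simp
    rw [h]
    exact measurableEmbedding_edgeSet.measurable (measurableSet_singleton _)⟩
  infer_instance

attribute [local instance] discreteMeasurableSpace_simpleGraph

lemma binomialRandom_real_singleton (p : unitInterval) (G : SimpleGraph V) :
    (binomialRandom V p).real {G} = (p : ℝ) ^ G.edgeSet.ncard *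
      (1 - (p : ℝ)) ^ ((Nat.card V).choose 2 - G.edgeSet.ncard) := by
  simp [measureReal_def]

lemma ncard_edgeSet_le (G : SimpleGraph V) : G.edgeSet.ncard ≤ (Nat.card V).choose 2 := by
  classical
  cases nonempty_fintype V
  rw [Nat.card_eq_fintype_card, ← Sym2.card_diagSet_compl, Fintype.card_eq_nat_card,
    Nat.card_coe_set_eq]
  exact Set.ncard_le_ncard (edgeSet_subset_compl_diagSet G)

/-- Adding `e` is a bijection between the two halves of `A`, and it trades one factor `1 - p` of the
weight for a factor `p`. The form without quotients also covers `p = 0` and `p = 1`. -/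
lemma binomialRandom_toggle (p : unitInterval) {e : Sym2 V} (he : ¬ e.IsDiag)
    {A : Set (SimpleGraph V)} (hA : Insensitive {e} A) :
    (p : ℝ) * (binomialRandom V p).real (A ∩ {G | e ∉ G.edgeSet}) =
      (1 - (p : ℝ)) * (binomialRandom V p).real (A ∩ {G | e ∈ G.edgeSet}) := by
  classical
  cases nonempty_fintype V
  have key : ∀ S : Set (SimpleGraph V), (binomialRandom V p).real S =
      ∑ G ∈ S.toFinset, (binomialRandom V p).real {G} := by
    intro S; rw [sum_measureReal_singleton]; simp
  rw [key, key, Finset.mul_sum, Finset.mul_sum]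
  have hadd : ∀ G : SimpleGraph V, (G ⊔ fromEdgeSet {e}).edgeSet = insert e G.edgeSet := by
    intro G
    rw [edgeSet_sup, edgeSet_fromEdgeSet, Set.union_comm, Set.insert_eq]
    congr 1
    ext f
    simp only [Set.mem_sdiff, Set.mem_singleton_iff]
    constructor
    · exact fun h => h.1
    · rintro rfl; exact ⟨rfl, he⟩
  refine Finset.sum_bij' (fun G _ => G ⊔ fromEdgeSet {e}) (fun G _ => G.deleteEdges {e}) ?_ ?_ ?_ ?_ ?_
  · intro G hG
    simp only [Set.mem_toFinset, Set.mem_inter_iff, Set.mem_ofPred_eq] at hG ⊢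
    refine ⟨hA G _ (fun f hf => ?_) hG.1, ?_⟩
    · rw [hadd]; simp at hf; simp [hf]
    · rw [hadd]; simp
  · intro G hG
    simp only [Set.mem_toFinset, Set.mem_inter_iff, Set.mem_ofPred_eq] at hG ⊢
    refine ⟨hA G _ (fun f hf => ?_) hG.1, ?_⟩
    · rw [edgeSet_deleteEdges]; simp at hf; simp [hf]
    · rw [edgeSet_deleteEdges]; simp
  · intro G hG
    simp only [Set.mem_toFinset, Set.mem_inter_iff, Set.mem_ofPred_eq] at hG
    rw [← edgeSet_inj, edgeSet_deleteEdges, hadd]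
    simp [hG.2]
  · intro G hG
    simp only [Set.mem_toFinset, Set.mem_inter_iff, Set.mem_ofPred_eq] at hG
    rw [← edgeSet_inj, hadd, edgeSet_deleteEdges]
    simp [Set.insert_eq_of_mem hG.2]
  · intro G hG
    simp only [Set.mem_toFinset, Set.mem_inter_iff, Set.mem_ofPred_eq] at hG
    rw [binomialRandom_real_singleton, binomialRandom_real_singleton, hadd,
      Set.ncard_insert_of_notMem hG.2]
    have hle := ncard_edgeSet_le (G ⊔ fromEdgeSet {e})
    rw [hadd, Set.ncard_insert_of_notMem hG.2] at hle
    obtain ⟨d, hd⟩ := Nat.exists_eq_add_of_le hle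
    rw [hd, show G.edgeSet.ncard + 1 + d - G.edgeSet.ncard = d + 1 by omega,
      show G.edgeSet.ncard + 1 + d - (G.edgeSet.ncard + 1) = d by omega]
    ring

lemma binomialRandom_inter_notMem_add (p : unitInterval) (e : Sym2 V) (A : Set (SimpleGraph V)) :
    (binomialRandom V p).real (A ∩ {G | e ∈ G.edgeSet}) +
      (binomialRandom V p).real (A ∩ {G | e ∉ G.edgeSet}) = (binomialRandom V p).real A := by
  have := measureReal_inter_add_sdiff (μ := binomialRandom V p) (s := A)
    (MeasurableSet.of_discrete (s := {G : SimpleGraph V | e ∈ G.edgeSet}))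
  rw [← this]
  rfl

lemma binomialRandom_inter_notMem (p : unitInterval) {e : Sym2 V} (he : ¬ e.IsDiag)
    {A : Set (SimpleGraph V)} (hA : Insensitive {e} A) :
    (binomialRandom V p).real (A ∩ {G | e ∉ G.edgeSet}) =
      (1 - (p : ℝ)) * (binomialRandom V p).real A := by
  have h1 := binomialRandom_toggle p he hA
  have h2 := binomialRandom_inter_notMem_add p e A
  rw [← h2]; linarith

lemma binomialRandom_inter_mem (p : unitInterval) {e : Sym2 V} (he : ¬ e.IsDiag)
    {A : Set (SimpleGraph V)} (hA : Insensitive {e} A) :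
    (binomialRandom V p).real (A ∩ {G | e ∈ G.edgeSet}) =
      (p : ℝ) * (binomialRandom V p).real A := by
  have h1 := binomialRandom_toggle p he hA
  have h2 := binomialRandom_inter_notMem_add p e A
  rw [← h2]; linarith

/-- The edges in `F` are independent of every event that is insensitive to `F`. -/
lemma binomialRandom_inter_disjoint (p : unitInterval) (F : Finset (Sym2 V))
    (hF : ∀ e ∈ F, ¬ e.IsDiag) {A : Set (SimpleGraph V)} (hA : Insensitive (F : Set (Sym2 V)) A) :
    (binomialRandom V p).real (A ∩ {G | ∀ e ∈ F, e ∉ G.edgeSet}) =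
      (1 - (p : ℝ)) ^ F.card * (binomialRandom V p).real A := by
  classical
  induction F using Finset.induction_on with
  | empty => simp
  | insert e F heF ih =>
    have h1 := ih (fun f hf => hF f (Finset.mem_insert_of_mem hf)) (hA.mono (by simp))
    have hset : A ∩ {G : SimpleGraph V | ∀ f ∈ insert e F, f ∉ G.edgeSet} =
        (A ∩ {G | ∀ f ∈ F, f ∉ G.edgeSet}) ∩ {G | e ∉ G.edgeSet} := by
      ext G
      simp only [Finset.mem_insert, forall_eq_or_imp, Set.mem_inter_iff, Set.mem_ofPred_eq]
      tauto
    rw [hset, binomialRandom_inter_notMem p (hF e (Finset.mem_insert_self _ _)), h1,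
      Finset.card_insert_of_notMem heF]
    · ring
    · rintro G G' hG ⟨hGA, hGF⟩
      refine ⟨hA.mono (by simp) G G' hG hGA, fun f hf hf' => hGF f hf ((hG f ?_).2 hf')⟩
      rintro rfl
      exact heF hf

lemma binomialRandom_subset (p : unitInterval) (F : Finset (Sym2 V))
    (hF : ∀ e ∈ F, ¬ e.IsDiag) :
    (binomialRandom V p).real {G | ∀ e ∈ F, e ∈ G.edgeSet} = (p : ℝ) ^ F.card := by
  classical
  induction F using Finset.induction_on with
  | empty => simp
  | insert e F heF ih =>
    have h1 := ih (fun f hf => hF f (Finset.mem_insert_of_mem hf))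
    have hset : {G : SimpleGraph V | ∀ f ∈ insert e F, f ∈ G.edgeSet} =
        {G | ∀ f ∈ F, f ∈ G.edgeSet} ∩ {G | e ∈ G.edgeSet} := by
      ext G
      simp only [Finset.mem_insert, forall_eq_or_imp, Set.mem_inter_iff, Set.mem_ofPred_eq]
      tauto
    rw [hset, binomialRandom_inter_mem p (hF e (Finset.mem_insert_self _ _)), h1,
      Finset.card_insert_of_notMem heF]
    · ring
    · intro G G' hG hGF f hf
      refine (hG f ?_).1 (hGF f hf)
      rintro rfl
      exact heF hf

lemma one_sub_pow_le_exp (p : unitInterval) (k : ℕ) :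
    (1 - (p : ℝ)) ^ k ≤ Real.exp (-(p * k)) := by
  have h : 1 - (p : ℝ) ≤ Real.exp (-p) := by
    have := Real.add_one_le_exp (-(p : ℝ)); linarith
  calc (1 - (p : ℝ)) ^ k ≤ Real.exp (-p) ^ k :=
        pow_le_pow_left₀ (by linarith [p.2.2]) h k
    _ = Real.exp (-(p * k)) := by rw [← Real.exp_nat_mul]; ring_nf

/-- Disjoint vertex sets `S`, `Y` are joined by an edge with high probability. -/
lemma binomialRandom_no_edge_le (p : unitInterval) (S Y : Finset V) (hSY : Disjoint S Y) :
    (binomialRandom V p).real {G | ∀ x ∈ S, ∀ y ∈ Y, ¬ G.Adj x y} ≤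
      Real.exp (-(p * (S.card * Y.card))) := by
  classical
  set F : Finset (Sym2 V) := (S ×ˢ Y).image fun z => s(z.1, z.2) with hFdef
  have hne : ∀ x ∈ S, ∀ y ∈ Y, x ≠ y := fun x hx y hy h =>
    Finset.disjoint_left.1 hSY hx (h ▸ hy)
  have hcard : F.card = S.card * Y.card := by
    rw [hFdef, Finset.card_image_of_injOn, Finset.card_product]
    rintro ⟨a, b⟩ hab ⟨c, d⟩ hcd h
    simp only [Finset.coe_product, Set.mem_prod, Finset.mem_coe] at hab hcd
    simp only [Sym2.eq_iff] at h
    rcases h with ⟨rfl, rfl⟩ | ⟨rfl, rfl⟩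
    · rfl
    · exact absurd rfl (hne _ hab.1 _ hcd.2)
  have hdiag : ∀ e ∈ F, ¬ e.IsDiag := by
    intro e he
    simp only [hFdef, Finset.mem_image, Finset.mem_product] at he
    obtain ⟨z, hz, rfl⟩ := he
    exact hne _ hz.1 _ hz.2
  have h := binomialRandom_inter_disjoint p F hdiag (A := Set.univ) (fun _ _ _ _ => trivial)
  simp only [Set.univ_inter, probReal_univ, mul_one] at h
  have hset : {G : SimpleGraph V | ∀ x ∈ S, ∀ y ∈ Y, ¬ G.Adj x y} =
      {G | ∀ e ∈ F, e ∉ G.edgeSet} := by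
    ext G
    simp only [hFdef, Set.mem_ofPred_eq, Finset.mem_image, Finset.mem_product]
    constructor
    · rintro h _ ⟨z, hz, rfl⟩
      exact h _ hz.1 _ hz.2
    · exact fun h x hx y hy => h s(x, y) ⟨(x, y), ⟨hx, hy⟩, rfl⟩
  rw [hset, h, hcard]
  simpa using one_sub_pow_le_exp p (S.card * Y.card)

/-- If `φ G` does not depend on the edges at `w`, then `w` has a neighbour in `φ G` with high
probability as soon as `φ G` is large. -/
lemma binomialRandom_no_edge_to_set_le (p : unitInterval) (w : V) (φ : SimpleGraph V → Finset V)
    (hw : ∀ G, w ∉ φ G)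
    (hφ : ∀ G G' : SimpleGraph V, (∀ x y, x ≠ w → y ≠ w → (G.Adj x y ↔ G'.Adj x y)) → φ G = φ G')
    (s : ℝ) :
    (binomialRandom V p).real {G | s ≤ (φ G).card ∧ ∀ x ∈ φ G, ¬ G.Adj w x} ≤
      Real.exp (-(p * s)) := by
  classical
  cases nonempty_fintype V
  -- Condition on the value `X` of `φ G`: this event is independent of the edges from `w` to `X`.
  -- The events for different `X` are disjoint, so summing over them costs nothing.
  set I : Finset (Finset V) := Finset.univ.filter fun X => s ≤ X.card ∧ w ∉ X with hI
  have hsub : {G : SimpleGraph V | s ≤ (φ G).card ∧ ∀ x ∈ φ G, ¬ G.Adj w x} ⊆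
      ⋃ X ∈ I, ({G | φ G = X} ∩ {G | ∀ e ∈ X.image (fun x => s(w, x)), e ∉ G.edgeSet}) := by
    intro G hG
    simp only [Set.mem_iUnion]
    refine ⟨φ G, by simp [hI, hG.1, hw], rfl, ?_⟩
    intro e he
    simp only [Finset.mem_image] at he
    obtain ⟨x, hx, rfl⟩ := he
    exact hG.2 x hx
  have hone : ∀ X ∈ I, (binomialRandom V p).real
      ({G | φ G = X} ∩ {G | ∀ e ∈ X.image (fun x => s(w, x)), e ∉ G.edgeSet}) ≤
      Real.exp (-(p * s)) * (binomialRandom V p).real {G | φ G = X} := by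
    intro X hX
    simp only [hI, Finset.mem_filter, Finset.mem_univ, true_and] at hX
    rw [binomialRandom_inter_disjoint p _ _ _]
    · refine mul_le_mul_of_nonneg_right ?_ measureReal_nonneg
      refine (one_sub_pow_le_exp p _).trans (Real.exp_le_exp.2 (neg_le_neg ?_))
      rw [Finset.card_image_of_injective _ (fun a b h => Sym2.congr_right.1 h)]
      exact mul_le_mul_of_nonneg_left hX.1 p.2.1
    · intro e he
      simp only [Finset.mem_image] at he
      obtain ⟨x, hx, rfl⟩ := he
      intro h
      simp only [Sym2.mk_isDiag_iff] at h
      exact hX.2 (h ▸ hx)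
    · intro G G' hG hGX
      simp only [Set.mem_ofPred_eq] at hGX ⊢
      rw [← hGX]
      refine (hφ G G' fun x y hx hy => hG s(x, y) ?_).symm
      simp only [Finset.coe_image, Set.mem_image, not_exists, not_and, Sym2.eq_iff]
      rintro z - (⟨rfl, -⟩ | ⟨rfl, -⟩)
      · exact hx rfl
      · exact hy rfl
  calc _ ≤ _ := measureReal_mono hsub (measure_ne_top _ _)
    _ ≤ ∑ X ∈ I, Real.exp (-(p * s)) * (binomialRandom V p).real {G | φ G = X} :=
        (measureReal_biUnion_finset_le _ _).trans (Finset.sum_le_sum hone)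
    _ = Real.exp (-(p * s)) * (binomialRandom V p).real (⋃ X ∈ I, {G | φ G = X}) := by
        rw [← Finset.mul_sum, measureReal_biUnion_finset]
        · intro X _ Y _ hXY
          refine Set.disjoint_left.2 fun G hG hG' => hXY ?_
          exact hG.symm.trans hG'
        · exact fun _ _ => MeasurableSet.of_discrete
    _ ≤ Real.exp (-(p * s)) := mul_le_of_le_one_right (Real.exp_pos _).le measureReal_le_one

/-- Upper tail of the number of edges in `F`. -/
lemma binomialRandom_many_edges_le (p : unitInterval) (F : Finset (Sym2 V))
    (hF : ∀ e ∈ F, ¬ e.IsDiag) (k : ℕ) (hk : 8 * (F.card * (p : ℝ)) ≤ k) :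
    (binomialRandom V p).real {G | k ≤ (G.edgeSet ∩ F).ncard} ≤ Real.exp (-k) := by
  classical
  have hsub : {G : SimpleGraph V | k ≤ (G.edgeSet ∩ F).ncard} ⊆
      ⋃ D ∈ F.powersetCard k, {G | ∀ e ∈ D, e ∈ G.edgeSet} := by
    intro G hG
    have hfin : (G.edgeSet ∩ F : Set (Sym2 V)).Finite := F.finite_toSet.inter_of_right _
    simp only [Set.mem_ofPred_eq] at hG
    rw [Set.ncard_eq_toFinset_card _ hfin] at hG
    obtain ⟨D, hD, hDk⟩ := Finset.exists_subset_card_eq hG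
    simp only [Set.mem_iUnion]
    refine ⟨D, Finset.mem_powersetCard.2 ⟨fun e he => ?_, hDk⟩, fun e he => ?_⟩
    · have := hD he; simp at this; exact this.2
    · have := hD he; simp at this; exact this.1
  have hp := p.2.1
  -- The constant 8 gives `|F| p ≤ k / e²`, so the first-moment bound `(|F| p)^k / k!` is at most
  -- `(k^k / k!) e^(-2k) ≤ e^(-k)`.
  have hexp : Real.exp 2 ≤ 8 := by
    have h := Real.exp_one_lt_d9
    have h' := Real.exp_pos 1
    rw [show (2 : ℝ) = 1 + 1 by norm_num, Real.exp_add]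
    nlinarith
  calc _ ≤ _ := measureReal_mono hsub (measure_ne_top _ _)
    _ ≤ ∑ D ∈ F.powersetCard k, (p : ℝ) ^ k := by
        refine (measureReal_biUnion_finset_le _ _).trans (Finset.sum_le_sum fun D hD => ?_)
        rw [Finset.mem_powersetCard] at hD
        rw [binomialRandom_subset p D fun e he => hF e (hD.1 he), hD.2]
    _ = (F.card.choose k : ℝ) * (p : ℝ) ^ k := by
        rw [Finset.sum_const, Finset.card_powersetCard, nsmul_eq_mul]
    _ ≤ ((F.card : ℝ) ^ k / k.factorial) * (p : ℝ) ^ k := by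
        gcongr; exact Nat.choose_le_pow_div _ _
    _ = (F.card * (p : ℝ)) ^ k / k.factorial := by rw [mul_pow]; ring
    _ ≤ (k * Real.exp (-2)) ^ k / k.factorial := by
        refine div_le_div_of_nonneg_right (pow_le_pow_left₀ (by positivity) ?_ k) (by positivity)
        rw [Real.exp_neg, ← div_eq_mul_inv, le_div_iff₀ (Real.exp_pos 2)]
        have : 0 ≤ F.card * (p : ℝ) := by positivity
        nlinarith
    _ = ((k : ℝ) ^ k / k.factorial) * Real.exp (-(2 * k)) := by
        rw [mul_pow, ← Real.exp_nat_mul]; ring_nf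
    _ ≤ Real.exp k * Real.exp (-(2 * k)) := by
        gcongr; exact Real.pow_div_factorial_le_exp _ (Nat.cast_nonneg _) _
    _ = Real.exp (-k) := by rw [← Real.exp_add]; ring_nf

end RandomGraph

end AvgLCA

namespace AvgLCA

open MeasureTheory SimpleGraph

/-! ### Expansion inside the center set and growth of balls. -/

section Expansion

variable {V : Type*} [DecidableEq V]

/-- Every nonempty set `S` has a neighbour in `C` outside `S` and outside any given set `R` that is
small compared with the expected size of the neighbourhood of `S` in `C`. -/
def Expands (G : SimpleGraph V) (C : Finset V) (p L : ℝ) : Prop :=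
  ∀ S R : Finset V, S.Nonempty → 4 * (S.card + R.card) * L ≤ p * (S.card * (C \ (S ∪ R)).card) →
    ∃ x ∈ S, ∃ y ∈ C \ (S ∪ R), G.Adj x y

/-- Geometric weights of pairs of finite sets, the first of which is nonempty. -/
lemma sum_pow_card_add_card_le [Fintype V] {x : ℝ} (hx : 0 ≤ x) (hx1 : Fintype.card V * x ≤ 1) :
    ∑ z : Finset V × Finset V, (if z.1.Nonempty then x ^ (z.1.card + z.2.card) else 0) ≤
      6 * (Fintype.card V * x) := by
  set N := Fintype.card V
  have hsum : ∑ S : Finset V, x ^ S.card = (x + 1) ^ N := by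
    have := Fintype.sum_pow_mul_eq_add_pow V x 1
    simpa using this
  -- Excluding `S = ∅` removes the constant term 1; this is what makes the total of order `N * x`.
  have hsum' : ∑ S : Finset V, (if S.Nonempty then x ^ S.card else 0) = (x + 1) ^ N - 1 := by
    rw [← hsum, eq_sub_iff_add_eq]
    have : (1 : ℝ) = ∑ S : Finset V, if S = ∅ then 1 else 0 := by simp
    rw [this, ← Finset.sum_add_distrib]
    refine Finset.sum_congr rfl fun S _ => ?_
    rcases S.eq_empty_or_nonempty with rfl | h
    · simp
    · simp [h, h.ne_empty]
  have hexp : (x + 1) ^ N ≤ Real.exp (N * x) := by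
    rw [Real.exp_nat_mul]
    exact pow_le_pow_left₀ (by linarith) (Real.add_one_le_exp x) N
  have hy : 0 ≤ N * x := by positivity
  have h1 : Real.exp (N * x) ≤ 1 + 2 * (N * x) := by
    have := Real.abs_exp_sub_one_le (x := N * x) (by rw [abs_of_nonneg hy]; exact hx1)
    rw [abs_of_nonneg hy] at this
    linarith [le_abs_self (Real.exp (N * x) - 1)]
  have h2 : (1 : ℝ) ≤ (x + 1) ^ N := one_le_pow₀ (by linarith)
  calc ∑ z : Finset V × Finset V, (if z.1.Nonempty then x ^ (z.1.card + z.2.card) else 0)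
      = ∑ z : Finset V × Finset V, (if z.1.Nonempty then x ^ z.1.card else 0) * x ^ z.2.card := by
        refine Finset.sum_congr rfl fun z _ => ?_
        split_ifs <;> simp [pow_add]
    _ = ((x + 1) ^ N - 1) * (x + 1) ^ N := by
        rw [Fintype.sum_prod_type, ← hsum', ← hsum, Finset.sum_mul_sum]
    _ ≤ (2 * (N * x)) * 3 := by
        refine mul_le_mul (by linarith) (by linarith) (by linarith) (by linarith)
    _ = 6 * (N * x) := by ring

/-- A union bound over `(S, R)`. The threshold in `Expands` makes a given pair fail with probability
at most `N ^ (-4 (|S| + |R|))`, which beats the at most `N ^ (|S| + |R|)` pairs of these sizes. -/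
lemma binomialRandom_not_expands_le [Fintype V] [Nonempty V] (p : unitInterval) (C : Finset V) :
    (binomialRandom V p).real {G | ¬ Expands G C p (Real.log (Fintype.card V))} ≤
      6 / (Fintype.card V : ℝ) ^ 3 := by
  set N : ℝ := (Fintype.card V : ℝ) with hN
  have hN1 : 1 ≤ N := by
    rw [hN]; exact_mod_cast Fintype.card_pos (α := V)
  have hN0 : 0 < N := by linarith
  let Bad : Finset V × Finset V → Set (SimpleGraph V) := fun z =>
    {G | z.1.Nonempty ∧ 4 * (z.1.card + z.2.card) * Real.log N ≤
      p * (z.1.card * (C \ (z.1 ∪ z.2)).card) ∧ ∀ x ∈ z.1, ∀ y ∈ C \ (z.1 ∪ z.2), ¬ G.Adj x y}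
  have hsub : {G : SimpleGraph V | ¬ Expands G C p (Real.log N)} ⊆
      ⋃ z ∈ (Finset.univ : Finset (Finset V × Finset V)), Bad z := by
    intro G hG
    simp only [Expands, Set.mem_ofPred_eq] at hG
    push Not at hG
    obtain ⟨S, R, hS, hle, hno⟩ := hG
    simp only [Set.mem_iUnion]
    exact ⟨(S, R), Finset.mem_univ _, hS, hle, hno⟩
  have hone : ∀ z, (binomialRandom V p).real (Bad z) ≤
      if z.1.Nonempty then ((N ^ 4)⁻¹) ^ (z.1.card + z.2.card) else 0 := by
    rintro ⟨S, R⟩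
    by_cases hS : S.Nonempty
    swap
    · have : Bad (S, R) = ∅ := by ext G; simp [Bad, hS]
      simp [this, hS]
    by_cases hle : 4 * (S.card + R.card) * Real.log N ≤ p * (S.card * (C \ (S ∪ R)).card)
    swap
    · have : Bad (S, R) = ∅ := by ext G; simp [Bad, hle]
      simp only [this, measureReal_empty, hS, if_true]
      positivity
    · simp only [hS, if_true]
      refine (measureReal_mono (fun G hG => hG.2.2) (measure_ne_top _ _)).trans
        ((binomialRandom_no_edge_le p S (C \ (S ∪ R)) ?_).trans ?_)
      · rw [Finset.disjoint_left]
        intro x hx hx'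
        simp [hx] at hx'
      · refine (Real.exp_le_exp.2 (neg_le_neg hle)).trans (le_of_eq ?_)
        rw [show -(4 * ((S.card : ℝ) + R.card) * Real.log N) =
          ((S.card + R.card : ℕ) : ℝ) * (-((4 : ℕ) * Real.log N)) by push_cast; ring,
          Real.exp_nat_mul, Real.exp_neg, Real.exp_nat_mul, Real.exp_log hN0]
  have hx1 : N * (N ^ 4)⁻¹ = 1 / N ^ 3 := by field_simp
  calc _ ≤ _ := measureReal_mono hsub (measure_ne_top _ _)
    _ ≤ _ := (measureReal_biUnion_finset_le _ _).trans (Finset.sum_le_sum fun z _ => hone z)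
    _ ≤ 6 * (N * (N ^ 4)⁻¹) := by
        refine sum_pow_card_add_card_le (by positivity) ?_
        rw [← hN, hx1, div_le_one (by positivity)]
        exact one_le_pow₀ hN1
    _ = 6 / N ^ 3 := by rw [hx1]; ring

open Classical in
/-- The vertices that are reached from `u` by a path of length at most `k` whose later vertices are
in `C` and different from `w`. -/
noncomputable def ballAvoiding (G : SimpleGraph V) (C : Finset V) (w u : V) : ℕ → Finset V
  | 0 => {u}
  | k + 1 => ballAvoiding G C w u k ∪
      C.filter fun x => x ≠ w ∧ ∃ y ∈ ballAvoiding G C w u k, G.Adj y x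

variable {G : SimpleGraph V} {C : Finset V} {u w : V}

lemma mem_ballAvoiding_succ {k : ℕ} {x : V} : x ∈ ballAvoiding G C w u (k + 1) ↔
    x ∈ ballAvoiding G C w u k ∨
      (x ∈ C ∧ x ≠ w ∧ ∃ y ∈ ballAvoiding G C w u k, G.Adj y x) := by
  simp [ballAvoiding]

lemma ballAvoiding_mono : Monotone (ballAvoiding G C w u) :=
  monotone_nat_of_le_succ fun _ _ hx => mem_ballAvoiding_succ.2 (Or.inl hx)

lemma notMem_ballAvoiding (h : u ≠ w) (k : ℕ) : w ∉ ballAvoiding G C w u k := by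
  induction k with
  | zero => simpa [ballAvoiding] using h.symm
  | succ k ih => rw [mem_ballAvoiding_succ]; simp [ih]

lemma ballAvoiding_subset (h : u ∈ C) (k : ℕ) : ballAvoiding G C w u k ⊆ C := by
  induction k with
  | zero => simpa [ballAvoiding] using h
  | succ k ih =>
    intro x hx
    rw [mem_ballAvoiding_succ] at hx
    exact hx.elim (fun h => ih h) fun h => h.1

/-- This is why the ball avoids `w`: the edges at `w` stay unexposed and can supply the last step of
the path. -/
lemma ballAvoiding_congr (h : u ≠ w) {G' : SimpleGraph V}
    (hG : ∀ x y, x ≠ w → y ≠ w → (G.Adj x y ↔ G'.Adj x y)) (k : ℕ) :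
    ballAvoiding G C w u k = ballAvoiding G' C w u k := by
  induction k with
  | zero => rfl
  | succ k ih =>
    ext x
    rw [mem_ballAvoiding_succ, mem_ballAvoiding_succ, ← ih]
    refine or_congr_right (and_congr_right fun _ => and_congr_right fun hx =>
      exists_congr fun y => and_congr_right fun hy => hG y x ?_ hx)
    rintro rfl
    exact notMem_ballAvoiding h k hy

lemma exists_walk_of_mem_ballAvoiding (hu : u ∈ C) {H : SimpleGraph V}
    (hH : ∀ x ∈ C, ∀ y ∈ C, G.Adj x y → H.Adj x y) (k : ℕ) {x : V}
    (hx : x ∈ ballAvoiding G C w u k) : ∃ q : H.Walk u x, q.length ≤ k := by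
  induction k generalizing x with
  | zero =>
    obtain rfl : x = u := by simpa [ballAvoiding] using hx
    exact ⟨.nil, le_rfl⟩
  | succ k ih =>
    rcases mem_ballAvoiding_succ.1 hx with hx | ⟨hxC, -, y, hy, hyx⟩
    · obtain ⟨q, hq⟩ := ih hx
      exact ⟨q, hq.trans (Nat.le_succ k)⟩
    · obtain ⟨q, hq⟩ := ih hy
      exact ⟨q.concat (hH y (ballAvoiding_subset hu k hy) x hxC hyx), by simpa using hq⟩

lemma card_ballAvoiding_pos (k : ℕ) : 1 ≤ (ballAvoiding G C w u k).card := by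
  have h : ballAvoiding G C w u 0 ⊆ ballAvoiding G C w u k := ballAvoiding_mono (Nat.zero_le k)
  simpa [ballAvoiding] using Finset.card_le_card h

/-- Let `R` consist of `w` and the new layer. Then `S` has no neighbour in `C \ (S ∪ R)`, so the
inequality required by `Expands` must fail. As `|S| + |R| ≤ |S'| + 1 ≤ 2 |S'|` and at least half of
`C` lies outside `S ∪ R`, this forces `p |C| |S| ≤ 16 L |S'|`. -/
lemma Expands.card_ballAvoiding_succ {p L lam : ℝ} (hG : Expands G C p L) (hp : 0 ≤ p) (hL : 0 < L)
    (hlam : 16 * L * lam ≤ p * C.card) (k : ℕ)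
    (hk : 2 * ((ballAvoiding G C w u (k + 1)).card + 1) ≤ C.card) :
    lam * (ballAvoiding G C w u k).card ≤ (ballAvoiding G C w u (k + 1)).card := by
  set S := ballAvoiding G C w u k with hS
  set S' := ballAvoiding G C w u (k + 1) with hS'
  have hSS' : S ⊆ S' := ballAvoiding_mono (Nat.le_succ k)
  set R := insert w (S' \ S) with hR
  have hRcard : S.card + R.card ≤ S'.card + 1 := by
    have h1 : R.card ≤ (S' \ S).card + 1 := Finset.card_insert_le w (S' \ S)
    have h2 := Finset.card_sdiff_add_card_eq_card hSS'
    omega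
  have hC : C.card ≤ (C \ (S ∪ R)).card + (S'.card + 1) := by
    have h1 := Finset.le_card_sdiff (S ∪ R) C
    have h2 := Finset.card_union_le S R
    omega
  have hlt : p * (S.card * (C \ (S ∪ R)).card) < 4 * (S.card + R.card) * L := by
    by_contra! h
    obtain ⟨x, hx, y, hy, hxy⟩ := hG S R (Finset.card_pos.1 (card_ballAvoiding_pos k)) h
    simp only [hR, Finset.mem_sdiff, Finset.mem_union, Finset.mem_insert, not_or, not_and,
      not_not] at hy
    exact hy.2.1 (hy.2.2.2 (mem_ballAvoiding_succ.2 (Or.inr ⟨hy.1, hy.2.2.1, x, hx, hxy⟩)))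
  have hpos : (1 : ℝ) ≤ S'.card := Nat.one_le_cast.2 (card_ballAvoiding_pos (k + 1))
  have hR' : (S.card : ℝ) + R.card ≤ S'.card + 1 := by exact_mod_cast hRcard
  have hC' : (C.card : ℝ) ≤ (C \ (S ∪ R)).card + (S'.card + 1) := by exact_mod_cast hC
  have hk' : 2 * ((S'.card : ℝ) + 1) ≤ C.card := by exact_mod_cast hk
  have hb : (0 : ℝ) ≤ S.card := Nat.cast_nonneg _
  have e1 : 4 * ((S.card : ℝ) + R.card) * L ≤ 8 * S'.card * L := by
    refine mul_le_mul_of_nonneg_right ?_ hL.le; linarith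
  have e2 : p * (S.card * ((C.card : ℝ) / 2)) ≤ p * (S.card * (C \ (S ∪ R)).card) := by
    gcongr; linarith
  have e3 : (16 * L * lam) * S.card ≤ (p * C.card) * S.card :=
    mul_le_mul_of_nonneg_right hlam hb
  have e4 : (lam * S.card) * (16 * L) ≤ S'.card * (16 * L) := by nlinarith
  exact le_of_mul_le_mul_right e4 (by linarith)

/-- Otherwise every one of the `j` steps multiplies the size by `lam`, and the ball would have at
least `lam ^ j ≥ |C|` elements. -/
lemma Expands.lt_card_ballAvoiding {p L lam : ℝ} (hG : Expands G C p L) (hp : 0 ≤ p) (hL : 0 < L)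
    (hlam0 : 0 ≤ lam) (hlam : 16 * L * lam ≤ p * C.card) (j : ℕ) (hj : C.card ≤ lam ^ j) :
    C.card < 2 * ((ballAvoiding G C w u j).card + 1) := by
  by_contra! h
  have key : ∀ k ≤ j, lam ^ k ≤ (ballAvoiding G C w u k).card := by
    intro k
    induction k with
    | zero => intro _; simp [ballAvoiding]
    | succ k ih =>
      intro hk
      have hle := Finset.card_le_card (ballAvoiding_mono (G := G) (C := C) (w := w) (u := u) hk)
      refine le_trans ?_ (hG.card_ballAvoiding_succ hp hL hlam k (by omega))
      rw [pow_succ']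
      exact mul_le_mul_of_nonneg_left (ih (by omega)) hlam0
  have h1 : (C.card : ℝ) ≤ (ballAvoiding G C w u j).card := hj.trans (key j le_rfl)
  have h2 : C.card ≤ (ballAvoiding G C w u j).card := by exact_mod_cast h1
  omega

end Expansion

/-! ### Stretch and size of the center subgraph. -/

section Spanner

lemma isSpanner_of_adj {V : Type*} {G H : SimpleGraph V} (hHG : H ≤ G) {D : ℕ} {k : ℝ}
    (hk : (D : ℝ) ≤ k) (h : ∀ u v, G.Adj u v → ∃ q : H.Walk u v, q.length ≤ D) :
    IsSpanner k G H := by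
  have key : ∀ u v (q : G.Walk u v), ∃ q' : H.Walk u v, q'.length ≤ D * q.length := by
    intro u v q
    induction q with
    | nil => exact ⟨.nil, by simp⟩
    | cons hadj q ih =>
      obtain ⟨q₁, h₁⟩ := h _ _ hadj
      obtain ⟨q₂, h₂⟩ := ih
      refine ⟨q₁.append q₂, ?_⟩
      rw [Walk.length_append, Walk.length_cons, Nat.mul_succ]
      omega
  refine ⟨hHG, fun u v huv => ?_⟩
  obtain ⟨q, hq⟩ := huv.exists_walk_length_eq_dist
  obtain ⟨q', hq'⟩ := key u v q
  refine ⟨q'.reachable, ?_⟩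
  have h1 : H.dist u v ≤ D * G.dist u v := (dist_le q').trans (hq ▸ hq')
  calc (H.dist u v : ℝ) ≤ D * G.dist u v := by exact_mod_cast h1
    _ ≤ k * G.dist u v := by gcongr

variable {n : ℕ} {G : SimpleGraph (Fin n)} {T : ℝ}

lemma centerSubgraph_le : centerSubgraph G T ≤ G := by
  rintro u v (⟨h, -⟩ | ⟨-, h, -⟩ | ⟨-, h, -⟩)
  exacts [h, h, h.symm]

lemma exists_isLowestCenterNbr {u : Fin n} (h : ∃ v, G.Adj u v ∧ IsCenter T v) :
    ∃ v, IsLowestCenterNbr G T u v := by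
  classical
  have hne : (Finset.univ.filter fun v => G.Adj u v ∧ IsCenter T v).Nonempty := by
    obtain ⟨v, hv⟩ := h
    exact ⟨v, by simpa using hv⟩
  have hmem := Finset.min'_mem _ hne
  simp only [Finset.mem_filter, Finset.mem_univ, true_and] at hmem
  exact ⟨_, hmem.1, hmem.2, fun w hw hw' => Finset.min'_le _ _ (by simp [hw, hw'])⟩

/-- Each endpoint is a center or hangs on one by an edge of `H`, so a detour through the centers
costs at most `1 + D + 1`. -/
lemma centerSubgraph_isSpanner {D : ℕ} {k : ℝ} (hk : (D : ℝ) + 2 ≤ k)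
    (hcenter : ∀ u v, IsCenter T u → IsCenter T v →
      ∃ q : (centerSubgraph G T).Walk u v, q.length ≤ D)
    (hnbr : ∀ u, ¬ IsCenter T u → ∃ v, G.Adj u v ∧ IsCenter T v) :
    IsSpanner k G (centerSubgraph G T) := by
  have hclose : ∀ u, ∃ c, IsCenter T c ∧ ∃ q : (centerSubgraph G T).Walk u c, q.length ≤ 1 := by
    intro u
    by_cases hu : IsCenter T u
    · exact ⟨u, hu, .nil, by simp⟩
    · obtain ⟨c, hc⟩ := exists_isLowestCenterNbr (hnbr u hu)
      have hadj : (centerSubgraph G T).Adj u c := Or.inr (Or.inl ⟨hu, hc⟩)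
      exact ⟨c, hc.2.1, hadj.toWalk, by simp⟩
  refine isSpanner_of_adj centerSubgraph_le (D := D + 2) (by exact_mod_cast hk) fun u v _ => ?_
  obtain ⟨c, hc, q₁, h₁⟩ := hclose u
  obtain ⟨d, hd, q₃, h₃⟩ := hclose v
  obtain ⟨q₂, h₂⟩ := hcenter c d hc hd
  refine ⟨(q₁.append q₂).append q₃.reverse, ?_⟩
  simp only [Walk.length_append, Walk.length_reverse]
  omega

/-- The potential edges between two different centers. -/
noncomputable def centerPairs (C : Finset (Fin n)) : Finset (Sym2 (Fin n)) :=
  C.offDiag.image fun z => s(z.1, z.2)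

lemma card_centerPairs_le (C : Finset (Fin n)) : (centerPairs C).card ≤ C.card ^ 2 := by
  refine Finset.card_image_le.trans ?_
  rw [Finset.offDiag_card, sq]
  omega

lemma not_isDiag_of_mem_centerPairs {C : Finset (Fin n)} {e : Sym2 (Fin n)}
    (he : e ∈ centerPairs C) : ¬ e.IsDiag := by
  simp only [centerPairs, Finset.mem_image, Finset.mem_offDiag] at he
  obtain ⟨z, hz, rfl⟩ := he
  exact hz.2.2

lemma ncard_edgeSet_centerSubgraph_le {C : Finset (Fin n)} (hC : ∀ v, v ∈ C ↔ IsCenter T v) :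
    (centerSubgraph G T).edgeSet.ncard ≤ n + (G.edgeSet ∩ centerPairs C).ncard := by
  classical
  set star : Set (Sym2 (Fin n)) :=
    {e | ∃ u v, IsLowestCenterNbr G T u v ∧ e = s(u, v)} with hstar
  have hsub : (centerSubgraph G T).edgeSet ⊆ star ∪ (G.edgeSet ∩ centerPairs C) := by
    intro e
    induction e using Sym2.ind with
    | _ u v =>
      rintro (⟨h, hu, hv⟩ | ⟨-, h⟩ | ⟨-, h⟩)
      · refine Or.inr ⟨h, ?_⟩
        simp only [centerPairs, Finset.coe_image, Set.mem_image]
        exact ⟨(u, v), by simp [hC, hu, hv, h.ne], rfl⟩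
      · exact Or.inl ⟨u, v, h, rfl⟩
      · exact Or.inl ⟨v, u, h, Sym2.eq_swap⟩
  have hstarcard : star.ncard ≤ n := by
    -- The lowest center neighbour is unique, so `star` lies in the image of a function on the
    -- vertices; `s(u, u)` is a dummy value.
    have : star ⊆ (fun u => if h : ∃ v, IsLowestCenterNbr G T u v then s(u, h.choose) else s(u, u)) ''
        (Set.univ : Set (Fin n)) := by
      rintro _ ⟨u, v, h, rfl⟩
      have hex : ∃ v, IsLowestCenterNbr G T u v := ⟨v, h⟩
      refine ⟨u, trivial, ?_⟩
      have heq : hex.choose = v := le_antisymm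
        (hex.choose_spec.2.2 v h.1 h.2.1) (h.2.2 _ hex.choose_spec.1 hex.choose_spec.2.1)
      simp only [hex, dif_pos, heq]
    refine (Set.ncard_le_ncard this (Set.toFinite _)).trans ((Set.ncard_image_le).trans ?_)
    simp [Set.ncard_univ]
  refine (Set.ncard_le_ncard hsub (Set.toFinite _)).trans ((Set.ncard_union_le _ _).trans ?_)
  omega

end Spanner

end AvgLCA

namespace AvgLCA

open SimpleGraph

/-! ### Probe strategies, their correctness and their cost. -/

section Algorithms

variable {n : ℕ} {G : SimpleGraph (Fin n)} {T : ℝ}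

open Classical in
/-- The deterministic algorithm for `centerSubgraph G T` that asks for the edge between two centers,
and uses `test u v` to decide whether the center `v` is the lowest neighbour of the non-center `u`. -/
noncomputable def centerLCA (n : ℕ) (T : ℝ) (test : Fin n → Fin n → ProbeTree n) : LCA n where
  tapeLength := 0
  run _ u v :=
    if IsCenter T u then
      if IsCenter T v then .probeExists u v .answer else test v u
    else
      if IsCenter T v then test u v else .answer false

lemma IsCenter.of_le {v w : Fin n} (hv : IsCenter T v) (h : w ≤ v) : IsCenter T w := by
  have : ((w : ℕ) : ℝ) ≤ (v : ℕ) := by exact_mod_cast h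
  unfold IsCenter at *
  linarith

/-- `v` is the lowest neighbour of `u`. -/
def IsLowestNbr (G : SimpleGraph (Fin n)) (u v : Fin n) : Prop :=
  G.Adj u v ∧ ∀ w, G.Adj u w → v ≤ w

/-- Every vertex below a center is a center, so a neighbour below `v` would compete with `v` in
either definition. The tests can therefore ignore `T`. -/
lemma isLowestCenterNbr_iff {u v : Fin n} (hv : IsCenter T v) :
    IsLowestCenterNbr G T u v ↔ IsLowestNbr G u v := by
  constructor
  · rintro ⟨h, -, hmin⟩
    refine ⟨h, fun w hw => ?_⟩
    by_contra! hlt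
    exact absurd (hmin w hw (hv.of_le hlt.le)) (not_le.2 hlt)
  · rintro ⟨h, hmin⟩
    exact ⟨h, hv, fun w hw _ => hmin w hw⟩

lemma centerLCA_givesAccess {test : Fin n → Fin n → ProbeTree n} {L : AdjList G}
    (h : ∀ u v, ¬ IsCenter T u → IsCenter T v →
      ((test u v).output L = true ↔ IsLowestNbr G u v)) :
    (centerLCA n T test).GivesAccess L (centerSubgraph G T) := by
  intro r u v
  by_cases hu : IsCenter T u <;> by_cases hv : IsCenter T v
  · simp [centerLCA, centerSubgraph, ProbeTree.output, hu, hv]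
  · simp [centerLCA, centerSubgraph, hu, hv, h v u hv hu, isLowestCenterNbr_iff hu]
  · simp [centerLCA, centerSubgraph, hu, hv, h u v hu hv, isLowestCenterNbr_iff hv]
  · simp [centerLCA, centerSubgraph, ProbeTree.output, hu, hv, IsLowestCenterNbr]

lemma centerLCA_expectedProbes_le {test : Fin n → Fin n → ProbeTree n} {L : AdjList G} {b : ℝ}
    (hb : 1 ≤ b) (h : ∀ u v, ((test u v).probes L : ℝ) ≤ b) (u v : Fin n) :
    (centerLCA n T test).expectedProbes L u v ≤ b := by
  have key : ∀ r, (((centerLCA n T test).run r u v).probes L : ℝ) ≤ b := by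
    intro r
    by_cases hu : IsCenter T u <;> by_cases hv : IsCenter T v <;>
      simp [centerLCA, ProbeTree.probes, hu, hv, h, hb, zero_le_one.trans hb]
  rw [LCA.expectedProbes, div_le_iff₀ (by positivity)]
  refine (Finset.sum_le_sum fun r _ => key r).trans (le_of_eq ?_)
  rw [Finset.sum_const, nsmul_eq_mul, Finset.card_univ]
  simp [mul_comm]

/-- With sorted adjacency lists, the lowest neighbour is the first entry. -/
def firstNbrTest (u v : Fin n) : ProbeTree n :=
  .probeNbr u 0 fun o => .answer (decide (o = some v))

lemma firstNbrTest_output {L : AdjList G} (hL : L.Sorted) (u v : Fin n) :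
    (firstNbrTest u v).output L = true ↔ IsLowestNbr G u v := by
  simp only [firstNbrTest, ProbeTree.output, decide_eq_true_eq]
  have hs := hL u
  have hm := L.mem_iff u
  rcases hl : L.nbrs u with _ | ⟨a, l⟩
  · rw [hl] at hm
    have : ¬ IsLowestNbr G u v := fun h => by simpa using (hm v).2 h.1
    simp [this]
  · rw [hl] at hm hs
    rw [List.pairwise_cons] at hs
    simp only [List.getElem?_cons_zero, Option.some.injEq]
    constructor
    · rintro rfl
      refine ⟨(hm a).1 (by simp), fun w hw => ?_⟩
      rcases List.mem_cons.1 ((hm w).2 hw) with rfl | h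
      · exact le_rfl
      · exact (hs.1 w h).le
    · rintro ⟨h, hmin⟩
      rcases List.mem_cons.1 ((hm v).2 h) with rfl | h'
      · rfl
      · exact absurd (hmin a ((hm a).1 (by simp))) (not_le.2 (hs.1 v h'))

/-- Answer no if one of the first `k` neighbours of `u` is below `v`. -/
def scanNbrs (u v : Fin n) : ℕ → ProbeTree n
  | 0 => .answer true
  | k + 1 => .probeNbr u k fun o =>
      if (o.any fun w => decide (w < v)) then .answer false else scanNbrs u v k

lemma scanNbrs_output (L : AdjList G) (u v : Fin n) (k : ℕ) :
    (scanNbrs u v k).output L = true ↔ ∀ i < k, ∀ w, (L.nbrs u)[i]? = some w → v ≤ w := by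
  induction k with
  | zero => simp [scanNbrs, ProbeTree.output]
  | succ k ih =>
    simp only [scanNbrs, ProbeTree.output, Nat.lt_succ_iff_lt_or_eq, or_imp, forall_and, forall_eq]
    split_ifs with h
    · simp only [ProbeTree.output, Bool.false_eq_true, false_iff, not_and]
      intro _ hk
      rw [Option.any_eq_true] at h
      obtain ⟨w, hw, hlt⟩ := h
      exact absurd (hk w hw) (not_le.2 (by simpa using hlt))
    · rw [ih]
      refine ⟨fun h' => ⟨h', fun w hw => ?_⟩, fun h' => h'.1⟩
      simpa [hw] using h

lemma scanNbrs_probes (L : AdjList G) (u v : Fin n) (k : ℕ) : (scanNbrs u v k).probes L ≤ k := by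
  induction k with
  | zero => simp [scanNbrs, ProbeTree.probes]
  | succ k ih =>
    simp only [scanNbrs, ProbeTree.probes]
    split_ifs
    · simp [ProbeTree.probes]
    · omega

/-- Decide by reading the first `k` neighbours of `u`. -/
def nbrsTest (k : ℕ) (u v : Fin n) : ProbeTree n :=
  .probeExists u v fun b => if b then scanNbrs u v k else .answer false

lemma nbrsTest_output {L : AdjList G} {k : ℕ} {u : Fin n} (hk : (L.nbrs u).length ≤ k) (v : Fin n) :
    (nbrsTest k u v).output L = true ↔ IsLowestNbr G u v := by
  by_cases h : G.Adj u v
  · simp only [nbrsTest, ProbeTree.output, h, decide_true, if_true, scanNbrs_output, IsLowestNbr,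
      true_and, ← L.mem_iff u, List.mem_iff_getElem?]
    constructor
    · rintro h' w ⟨i, hi⟩
      have := (List.getElem?_eq_some_iff.1 hi).1
      exact h' i (by omega) w hi
    · exact fun h' i _ w hw => h' w ⟨i, hw⟩
  · simp [nbrsTest, ProbeTree.output, h, IsLowestNbr]

lemma nbrsTest_probes (L : AdjList G) (k : ℕ) (u v : Fin n) :
    (nbrsTest k u v).probes L ≤ k + 1 := by
  simp only [nbrsTest, ProbeTree.probes]
  have := scanNbrs_probes L u v k
  split_ifs
  · omega
  · simp [ProbeTree.probes]

/-- Answer no if `u` has a neighbour in the list. -/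
def scanPairs (u : Fin n) : List (Fin n) → ProbeTree n
  | [] => .answer true
  | w :: l => .probeExists u w fun b => if b then .answer false else scanPairs u l

lemma scanPairs_output (L : AdjList G) (u : Fin n) (l : List (Fin n)) :
    (scanPairs u l).output L = true ↔ ∀ w ∈ l, ¬ G.Adj u w := by
  induction l with
  | nil => simp [scanPairs, ProbeTree.output]
  | cons a l ih =>
    by_cases h : G.Adj u a
    · simp [scanPairs, ProbeTree.output, h]
    · simp [scanPairs, ProbeTree.output, h, ih]

lemma scanPairs_probes (L : AdjList G) (u : Fin n) (l : List (Fin n)) :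
    (scanPairs u l).probes L ≤ l.length := by
  induction l with
  | nil => simp [scanPairs, ProbeTree.probes]
  | cons a l ih =>
    by_cases h : G.Adj u a
    · simp [scanPairs, ProbeTree.probes, h]
    · simpa [scanPairs, ProbeTree.probes, h] using ih

/-- Decide by testing the pairs `u`, `w` with `w ≤ v`, if `v` is among the first `m` vertices. -/
def pairsTest (m : ℕ) (u v : Fin n) : ProbeTree n :=
  if (v : ℕ) < m then
    .probeExists u v fun b =>
      if b then scanPairs u ((List.finRange n).take v) else .answer false
  else .answer false

/-- A neighbour of `u` below `m` justifies the refusal of every `v ≥ m` without a probe. -/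
lemma pairsTest_output {m : ℕ} {u : Fin n} (L : AdjList G)
    (hu : ∃ w : Fin n, (w : ℕ) < m ∧ G.Adj u w) (v : Fin n) :
    (pairsTest m u v).output L = true ↔ IsLowestNbr G u v := by
  by_cases hv : (v : ℕ) < m
  · by_cases h : G.Adj u v
    · have hmem : ∀ w : Fin n, w ∈ (List.finRange n).take v ↔ w < v := by
        intro w
        rw [List.mem_take_iff_getElem]
        constructor
        · rintro ⟨i, hi, rfl⟩
          simp at hi
          simpa [Fin.lt_def] using hi
        · intro hw
          exact ⟨w, by rw [List.length_finRange, lt_min_iff]; exact ⟨hw, w.2⟩, by simp⟩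
      simp only [pairsTest, hv, if_true, ProbeTree.output, h, decide_true, scanPairs_output,
        IsLowestNbr, true_and, hmem]
      exact forall_congr' fun w => by rw [← not_lt]; tauto
    · simp [pairsTest, ProbeTree.output, h, hv, IsLowestNbr]
  · simp only [pairsTest, hv, if_false, ProbeTree.output, Bool.false_eq_true, false_iff]
    rintro ⟨-, hmin⟩
    obtain ⟨w, hw, huw⟩ := hu
    have : (v : ℕ) ≤ w := hmin w huw
    omega

lemma pairsTest_probes (L : AdjList G) (m : ℕ) (u v : Fin n) :
    (pairsTest m u v).probes L ≤ m := by
  by_cases hv : (v : ℕ) < m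
  · simp only [pairsTest, hv, if_true, ProbeTree.probes]
    split_ifs
    · have := scanPairs_probes L u ((List.finRange n).take v)
      rw [List.length_take] at this
      omega
    · simp only [ProbeTree.probes]; omega
  · simp [pairsTest, hv, ProbeTree.probes]

end Algorithms

end AvgLCA

namespace AvgLCA

open MeasureTheory SimpleGraph

/-! ### Typical graphs: their probability, and the spanner property they imply. -/

section Typical

variable {n : ℕ}

/-- The potential edges at `u`. -/
noncomputable def pairsAt (u : Fin n) : Finset (Sym2 (Fin n)) :=
  (Finset.univ.erase u).image fun v => s(u, v)

lemma card_pairsAt_le (u : Fin n) : (pairsAt u).card ≤ n := by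
  refine Finset.card_image_le.trans (Finset.card_erase_le.trans ?_)
  simp

lemma not_isDiag_of_mem_pairsAt {u : Fin n} {e : Sym2 (Fin n)} (he : e ∈ pairsAt u) :
    ¬ e.IsDiag := by
  simp only [pairsAt, Finset.mem_image, Finset.mem_erase, Finset.mem_univ, and_true] at he
  obtain ⟨v, hv, rfl⟩ := he
  exact fun h => hv h.symm

lemma AdjList.length_nbrs_le {G : SimpleGraph (Fin n)} (L : AdjList G) (u : Fin n) :
    (L.nbrs u).length ≤ (G.edgeSet ∩ pairsAt u).ncard := by
  classical
  rw [← List.toFinset_card_of_nodup (L.nodup u),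
    ← Finset.card_image_of_injective _ (fun a b h => Sym2.congr_right.1 h : Function.Injective
      fun v => s(u, v)), ← Set.ncard_coe_finset]
  refine Set.ncard_le_ncard ?_ (Set.toFinite _)
  intro e he
  simp only [Finset.coe_image, Set.mem_image, Finset.mem_coe, List.mem_toFinset, L.mem_iff] at he
  obtain ⟨v, hv, rfl⟩ := he
  refine ⟨hv, ?_⟩
  simp only [pairsAt, Finset.coe_image, Set.mem_image]
  exact ⟨v, by simpa using hv.ne', rfl⟩

/-- The properties of a random graph that the analysis of the spanner and of the algorithms uses. -/
structure Typical (G : SimpleGraph (Fin n)) (C : Finset (Fin n)) (p : ℝ) (j k M : ℕ) (f : ℝ) :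
    Prop where
  expands : Expands G C p (Real.log n)
  adj_ball : ∀ u w, u ≠ w → (C.card : ℝ) / 4 ≤ (ballAvoiding G C w u j).card →
    ∃ x ∈ ballAvoiding G C w u j, G.Adj w x
  center_edges : ((G.edgeSet ∩ centerPairs C).ncard : ℝ) < f
  degree : ∀ u : Fin n, (G.edgeSet ∩ pairsAt u).ncard < k
  low_nbr : ∀ u ∉ C, ∃ w : Fin n, (w : ℕ) < M ∧ G.Adj u w

lemma card_filter_val_lt {M : ℕ} (hM : M ≤ n) :
    (Finset.univ.filter fun v : Fin n => (v : ℕ) < M).card = M := by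
  simp [Fin.card_filter_val_lt, hM]

/-- Failure of expansion costs `6 / n³`. Each other bad event has an exponent of at least `4 log n`,
hence probability at most `n⁻⁴`, and there are at most `n² + 1 + 2n` of them. -/
lemma binomialRandom_typical_ge (hn : 5 ≤ n) (p : unitInterval) (C : Finset (Fin n)) (j k M : ℕ)
    (f : ℝ) (hC : 16 * Real.log n ≤ p * C.card)
    (hf : 8 * ((C.card : ℝ) ^ 2 * p) ≤ f) (hf' : 4 * Real.log n ≤ f)
    (hk : 8 * (n * (p : ℝ)) ≤ k) (hk' : 4 * Real.log n ≤ k)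
    (hMn : M ≤ n) (hM : 4 * Real.log n ≤ p * M) (hMC : ∀ v : Fin n, (v : ℕ) < M → v ∈ C) :
    1 - 1 / (n : ℝ) ≤ (binomialRandom (Fin n) p).real {G | Typical G C p j k M f} := by
  classical
  have : DiscreteMeasurableSpace (SimpleGraph (Fin n)) := discreteMeasurableSpace_simpleGraph
  have : Nonempty (Fin n) := ⟨⟨0, by omega⟩⟩
  set μ := binomialRandom (Fin n) p with hμ
  have hn5 : (5 : ℝ) ≤ n := by exact_mod_cast hn
  have hn0 : (0 : ℝ) < n := by linarith
  have hp0 : (0 : ℝ) ≤ p := p.2.1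
  have hexp : ∀ t : ℝ, 4 * Real.log n ≤ t → Real.exp (-t) ≤ ((n : ℝ) ^ 4)⁻¹ := by
    intro t ht
    refine (Real.exp_le_exp.2 (neg_le_neg ht)).trans (le_of_eq ?_)
    rw [Real.exp_neg, show (4 : ℝ) * Real.log n = (4 : ℕ) * Real.log n by norm_num,
      Real.exp_nat_mul, Real.exp_log hn0]
  let B₁ : Set (SimpleGraph (Fin n)) := {G | ¬ Expands G C p (Real.log n)}
  let B₂ : Set (SimpleGraph (Fin n)) := ⋃ z ∈ (Finset.univ : Finset (Fin n × Fin n)),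
    {G | z.1 ≠ z.2 ∧ (C.card : ℝ) / 4 ≤ (ballAvoiding G C z.2 z.1 j).card ∧
      ∀ x ∈ ballAvoiding G C z.2 z.1 j, ¬ G.Adj z.2 x}
  let B₃ : Set (SimpleGraph (Fin n)) := {G | ⌈f⌉₊ ≤ (G.edgeSet ∩ centerPairs C).ncard}
  let B₄ : Set (SimpleGraph (Fin n)) := ⋃ u ∈ (Finset.univ : Finset (Fin n)),
    {G | k ≤ (G.edgeSet ∩ pairsAt u).ncard}
  let B₅ : Set (SimpleGraph (Fin n)) := ⋃ u ∈ Cᶜ,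
    {G | ∀ x ∈ ({u} : Finset (Fin n)), ∀ y ∈ Finset.univ.filter fun v : Fin n => (v : ℕ) < M,
      ¬ G.Adj x y}
  have hsub : {G | Typical G C p j k M f}ᶜ ⊆ B₁ ∪ (B₂ ∪ (B₃ ∪ (B₄ ∪ B₅))) := by
    intro G hG
    by_contra hcon
    simp only [Set.mem_union, not_or] at hcon
    obtain ⟨h1, h2, h3, h4, h5⟩ := hcon
    refine hG ⟨not_not.1 h1, fun u w huw hle => ?_, ?_, fun u => ?_, fun u hu => ?_⟩
    · by_contra! hno
      refine h2 ?_
      simp only [B₂, Set.mem_iUnion]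
      exact ⟨(u, w), Finset.mem_univ _, huw, hle, hno⟩
    · exact Nat.lt_ceil.1 (not_le.1 h3)
    · by_contra! hle
      refine h4 ?_
      simp only [B₄, Set.mem_iUnion]
      exact ⟨u, Finset.mem_univ _, hle⟩
    · by_contra! hno
      refine h5 ?_
      simp only [B₅, Set.mem_iUnion]
      refine ⟨u, Finset.mem_compl.2 hu, ?_⟩
      simpa using hno
  have b1 : μ.real B₁ ≤ 6 / (n : ℝ) ^ 3 := by
    simpa using binomialRandom_not_expands_le p C
  have b2 : μ.real B₂ ≤ (n : ℝ) ^ 2 * ((n : ℝ) ^ 4)⁻¹ := by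
    refine (measureReal_biUnion_finset_le _ _).trans ((Finset.sum_le_card_nsmul _ _
      (((n : ℝ) ^ 4)⁻¹) fun z _ => ?_).trans (le_of_eq ?_))
    · by_cases hz : z.1 = z.2
      · simp only [hz, ne_eq, not_true_eq_false, false_and]
        simp
      · refine (measureReal_mono (fun G hG => hG.2) (measure_ne_top _ _)).trans
          ((binomialRandom_no_edge_to_set_le p z.2 (fun G => ballAvoiding G C z.2 z.1 j)
            (fun G => notMem_ballAvoiding hz j) (fun G G' h => ballAvoiding_congr hz h j)
            ((C.card : ℝ) / 4)).trans (hexp _ ?_))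
        linarith
    · simp [sq]
  have b3 : μ.real B₃ ≤ ((n : ℝ) ^ 4)⁻¹ := by
    refine (binomialRandom_many_edges_le p (centerPairs C)
      (fun e => not_isDiag_of_mem_centerPairs) ⌈f⌉₊ ?_).trans (hexp _ (hf'.trans (Nat.le_ceil f)))
    refine le_trans ?_ (hf.trans (Nat.le_ceil f))
    have : ((centerPairs C).card : ℝ) ≤ (C.card : ℝ) ^ 2 := by exact_mod_cast card_centerPairs_le C
    gcongr
  have b4 : μ.real B₄ ≤ n * ((n : ℝ) ^ 4)⁻¹ := by
    refine (measureReal_biUnion_finset_le _ _).trans ((Finset.sum_le_card_nsmul _ _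
      (((n : ℝ) ^ 4)⁻¹) fun u _ => ?_).trans (le_of_eq (by simp)))
    refine (binomialRandom_many_edges_le p (pairsAt u)
      (fun e => not_isDiag_of_mem_pairsAt) k ?_).trans (hexp _ hk')
    refine le_trans ?_ hk
    have : ((pairsAt u).card : ℝ) ≤ n := by exact_mod_cast card_pairsAt_le u
    gcongr
  have b5 : μ.real B₅ ≤ n * ((n : ℝ) ^ 4)⁻¹ := by
    refine (measureReal_biUnion_finset_le _ _).trans ((Finset.sum_le_card_nsmul _ _
      (((n : ℝ) ^ 4)⁻¹) fun u hu => ?_).trans ?_)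
    · refine (binomialRandom_no_edge_le p {u} _ ?_).trans (hexp _ ?_)
      · rw [Finset.disjoint_singleton_left]
        intro h
        exact Finset.mem_compl.1 hu (hMC u (by simpa using h))
      · rw [card_filter_val_lt hMn]
        simpa using hM
    · rw [nsmul_eq_mul]
      gcongr
      exact (Finset.card_le_univ _).trans (by simp)
  have htot : μ.real {G | Typical G C p j k M f}ᶜ ≤ 1 / n := by
    have h1 := measureReal_mono (μ := μ) hsub (measure_ne_top _ _)
    have h2 := measureReal_union_le (μ := μ) B₁ (B₂ ∪ (B₃ ∪ (B₄ ∪ B₅)))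
    have h3 := measureReal_union_le (μ := μ) B₂ (B₃ ∪ (B₄ ∪ B₅))
    have h4 := measureReal_union_le (μ := μ) B₃ (B₄ ∪ B₅)
    have h5 := measureReal_union_le (μ := μ) B₄ B₅
    have h6 : 6 / (n : ℝ) ^ 3 + (n : ℝ) ^ 2 * ((n : ℝ) ^ 4)⁻¹ + ((n : ℝ) ^ 4)⁻¹ +
        2 * (n * ((n : ℝ) ^ 4)⁻¹) ≤ 1 / n := by
      have : 6 / (n : ℝ) ^ 3 + (n : ℝ) ^ 2 * ((n : ℝ) ^ 4)⁻¹ + ((n : ℝ) ^ 4)⁻¹ +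
        2 * (n * ((n : ℝ) ^ 4)⁻¹) = (n ^ 2 + 8 * n + 1) / (n : ℝ) ^ 4 := by
        field_simp; ring
      rw [this, div_le_div_iff₀ (by positivity) hn0]
      have e : (n : ℝ) ^ 2 + 8 * n + 1 ≤ n ^ 3 := by nlinarith
      nlinarith
    linarith
  rw [probReal_compl_eq_one_sub MeasurableSet.of_discrete] at htot
  linarith

/-- On a typical graph, the center subgraph is a sparse spanner. -/
lemma Typical.isSpanner {G : SimpleGraph (Fin n)} {C : Finset (Fin n)} {p : ℝ} {j k M : ℕ} {f : ℝ}
    (h : Typical G C p j k M f) {T : ℝ} (hC : ∀ v, v ∈ C ↔ IsCenter T v) (hp : 0 ≤ p)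
    (hn : 0 < Real.log n) {lam : ℝ} (hlam1 : 1 ≤ lam) (hlam : 16 * Real.log n * lam ≤ p * C.card)
    (hj : C.card ≤ lam ^ j) {κ : ℝ} (hκ : (j : ℝ) + 3 ≤ κ) :
    IsSpanner κ G (centerSubgraph G T) := by
  have hsub : ∀ x ∈ C, ∀ y ∈ C, G.Adj x y → (centerSubgraph G T).Adj x y :=
    fun x hx y hy hxy => Or.inl ⟨hxy, (hC x).1 hx, (hC y).1 hy⟩
  -- At most `j` steps inside the ball around `u`, and one more edge into `w`.
  refine centerSubgraph_isSpanner (D := j + 1) (by push_cast; linarith) (fun u w hu hw => ?_)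
    fun u hu => ?_
  · by_cases huw : u = w
    · subst huw; exact ⟨.nil, by simp⟩
    have huC := (hC u).2 hu
    have hball : (C.card : ℝ) / 4 ≤ (ballAvoiding G C w u j).card := by
      have h1 := h.expands.lt_card_ballAvoiding (w := w) (u := u) hp hn (by linarith) hlam j hj
      have h2 := card_ballAvoiding_pos (G := G) (C := C) (w := w) (u := u) j
      have h3 : C.card ≤ 4 * (ballAvoiding G C w u j).card := by omega
      have h4 : (C.card : ℝ) ≤ 4 * (ballAvoiding G C w u j).card := by exact_mod_cast h3
      linarith
    obtain ⟨x, hx, hwx⟩ := h.adj_ball u w huw hball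
    obtain ⟨q, hq⟩ := exists_walk_of_mem_ballAvoiding huC hsub j hx
    refine ⟨q.concat (hsub x (ballAvoiding_subset huC j hx) w ((hC w).2 hw) hwx.symm), ?_⟩
    simpa using hq
  · have huC : u ∉ C := fun h => hu ((hC u).1 h)
    -- Expansion of the singleton `{u}` already gives a center neighbour.
    obtain ⟨x, hx, y, hy, hxy⟩ := h.expands {u} ∅ (by simp) (by
      rw [Finset.union_empty, Finset.sdiff_singleton_eq_erase, Finset.erase_eq_of_notMem huC]
      simp only [Finset.card_singleton, Finset.card_empty]
      push_cast
      nlinarith)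
    rw [Finset.mem_singleton] at hx
    subst hx
    exact ⟨y, hxy, (hC y).1 (Finset.mem_sdiff.1 hy).1⟩

end Typical

end AvgLCA

/-! ### Asymptotic estimates and the test that suits the density. -/

namespace AvgLCA

open Filter SimpleGraph

/-- Any gap between exponents absorbs constants and a logarithm; all conditions "for large `n`" on
the parameters are reduced to this. -/
lemma eventually_mul_rpow_mul_log_le (c : ℝ) {a b : ℝ} (hab : a < b) :
    ∀ᶠ n : ℕ in atTop, c * (n : ℝ) ^ a * Real.log n ≤ (n : ℝ) ^ b := by
  have h := (isLittleO_log_rpow_atTop (sub_pos.2 hab)).comp_tendsto tendsto_natCast_atTop_atTop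
  have h' := h.bound (c := (|c| + 1)⁻¹) (by positivity)
  filter_upwards [h', eventually_ge_atTop 1] with n hn hn1
  have hn1' : (1 : ℝ) ≤ n := by exact_mod_cast hn1
  have hn0 : (0 : ℝ) < n := by linarith
  have hlog : 0 ≤ Real.log n := Real.log_nonneg hn1'
  simp only [Function.comp_apply, Real.norm_eq_abs] at hn
  rw [abs_of_nonneg hlog, abs_of_nonneg (Real.rpow_nonneg hn0.le _), ← div_eq_inv_mul,
    le_div_iff₀ (by positivity)] at hn
  calc c * (n : ℝ) ^ a * Real.log n ≤ (|c| + 1) * (n : ℝ) ^ a * Real.log n := by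
        gcongr
        linarith [le_abs_self c]
    _ = (n : ℝ) ^ a * (Real.log n * (|c| + 1)) := by ring
    _ ≤ (n : ℝ) ^ a * (n : ℝ) ^ (b - a) := by gcongr
    _ = (n : ℝ) ^ b := by rw [← Real.rpow_add hn0]; ring_nf

/-- The test for the lowest neighbour that makes fewer probes at the density `n ^ (δ - 1)`. -/
noncomputable def cheaperTest (δ : ℝ) (n : ℕ) : Fin n → Fin n → ProbeTree n :=
  if (n : ℝ) ^ δ ≤ (n : ℝ) ^ (1 - δ) * Real.log n then nbrsTest ⌈8 * (n : ℝ) ^ δ⌉₊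
  else pairsTest ⌈4 * ((n : ℝ) ^ (1 - δ) * Real.log n)⌉₊

lemma cheaperTest_output {n : ℕ} {G : SimpleGraph (Fin n)} {C : Finset (Fin n)} {p δ f : ℝ} {j : ℕ}
    (h : Typical G C p j ⌈8 * (n : ℝ) ^ δ⌉₊ ⌈4 * ((n : ℝ) ^ (1 - δ) * Real.log n)⌉₊ f)
    (L : AdjList G) {u : Fin n} (hu : u ∉ C) (v : Fin n) :
    (cheaperTest δ n u v).output L = true ↔ IsLowestNbr G u v := by
  unfold cheaperTest
  split_ifs
  · exact nbrsTest_output ((L.length_nbrs_le u).trans (h.degree u).le) v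
  · exact pairsTest_output L (h.low_nbr u hu) v

lemma cheaperTest_probes_le {n : ℕ} {G : SimpleGraph (Fin n)} {δ : ℝ} (h₁ : 1 ≤ (n : ℝ) ^ δ)
    (h₂ : 1 ≤ (n : ℝ) ^ (1 - δ) * Real.log n) (L : AdjList G) (u v : Fin n) :
    ((cheaperTest δ n u v).probes L : ℝ) ≤
      10 * min ((n : ℝ) ^ δ) ((n : ℝ) ^ (1 - δ) * Real.log n) := by
  unfold cheaperTest
  split_ifs with h
  · rw [min_eq_left h]
    have e1 : ((nbrsTest ⌈8 * (n : ℝ) ^ δ⌉₊ u v).probes L : ℝ) ≤ ⌈8 * (n : ℝ) ^ δ⌉₊ + 1 := by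
      exact_mod_cast nbrsTest_probes L _ u v
    have e2 := Nat.ceil_lt_add_one (a := 8 * (n : ℝ) ^ δ) (by linarith)
    linarith
  · rw [min_eq_right (not_le.1 h).le]
    set x := (n : ℝ) ^ (1 - δ) * Real.log n
    have e1 : ((pairsTest ⌈4 * x⌉₊ u v).probes L : ℝ) ≤ ⌈4 * x⌉₊ := by
      exact_mod_cast pairsTest_probes L _ u v
    have e2 := Nat.ceil_lt_add_one (a := 4 * x) (by linarith)
    linarith

lemma exists_center_finset {n : ℕ} {T : ℝ} (hT0 : 0 ≤ T) (hT : T ≤ n) :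
    ∃ C : Finset (Fin n), (∀ v, v ∈ C ↔ IsCenter T v) ∧ (C.card : ℝ) ≤ T ∧ T - 1 ≤ C.card := by
  refine ⟨Finset.univ.filter fun v : Fin n => (v : ℕ) < ⌊T⌋₊, fun v => ?_, ?_⟩
  · simp only [Finset.mem_filter, Finset.mem_univ, true_and, IsCenter]
    rw [← Nat.succ_le_iff, Nat.le_floor_iff hT0]
    simp
  · rw [card_filter_val_lt (Nat.floor_le_of_le hT)]
    exact ⟨Nat.floor_le hT0, by linarith [Nat.lt_floor_add_one T]⟩

lemma isLittleO_rpow_natCast {a : ℝ} (ha : a < 1) :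
    (fun n : ℕ => (n : ℝ) ^ a) =o[atTop] fun n : ℕ => (n : ℝ) := by
  refine Asymptotics.isLittleO_iff.2 fun c hc => ?_
  filter_upwards [eventually_mul_rpow_mul_log_le c⁻¹ ha,
    (Real.tendsto_log_atTop.comp tendsto_natCast_atTop_atTop).eventually_ge_atTop 1] with n h hlog
  have h0 : (0 : ℝ) ≤ (n : ℝ) ^ a := by positivity
  rw [Real.rpow_one, mul_assoc, inv_mul_le_iff₀ hc] at h
  rw [Real.norm_of_nonneg h0, Real.norm_of_nonneg (Nat.cast_nonneg n)]
  exact (le_mul_of_one_le_right h0 hlog).trans h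

end AvgLCA

/-! ### The choice of parameters and the main theorem. -/

theorem theorem1p6 :
    ∃ K : ℝ, ∀ (δ : ℝ), 0 < δ → δ ≤ 1 →
      ∀ (p : ℕ → unitInterval), (∀ n : ℕ, (n : ℝ) * (p n : ℝ) = (n : ℝ) ^ δ) →
      ∃ (A B : (n : ℕ) → AvgLCA.LCA n) (f : ℕ → ℝ),
        Asymptotics.IsLittleO Filter.atTop f (fun n : ℕ => (n : ℝ)) ∧
        -- with probability at least `1 - 1/n`, both algorithms give access to the same sparse spanner
        (∀ᶠ n : ℕ in Filter.atTop,
          1 - 1 / (n : ℝ) ≤ (SimpleGraph.binomialRandom (Fin n) (p n)).real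
            {G | ∃ H : SimpleGraph (Fin n),
              H = AvgLCA.centerSubgraph G ((n : ℝ) ^ (1 - δ / 2 - δ ^ 2 / 8)) ∧
              AvgLCA.IsSpanner (2 / δ + 5) G H ∧
              (H.edgeSet.ncard : ℝ) ≤ n + f n ∧
              (∀ L : AvgLCA.AdjList G, L.Sorted → (A n).GivesAccess L H) ∧
              (∀ L : AvgLCA.AdjList G, (B n).GivesAccess L H)}) ∧
        -- probe complexity with sorted adjacency lists
        (∀ (n : ℕ) (G : SimpleGraph (Fin n)) (L : AvgLCA.AdjList G), L.Sorted →
          ∀ u v, (A n).expectedProbes L u v ≤ 1) ∧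
        -- probe complexity with arbitrary adjacency lists
        (∀ᶠ n : ℕ in Filter.atTop, ∀ (G : SimpleGraph (Fin n)) (L : AvgLCA.AdjList G) (u v : Fin n),
          (B n).expectedProbes L u v ≤
            K * min ((n : ℝ) ^ δ) ((n : ℝ) ^ (1 - δ) * Real.log n)) := by
  open AvgLCA in
  -- Reading neighbours costs at most `⌈8x⌉ + 1 ≤ 10x` probes with `x = n ^ δ ≥ 1`; testing pairs
  -- costs less than `5x` for its own `x`.
  refine ⟨10, fun δ hδ0 hδ1 p hp => ?_⟩
  set τ : ℝ := 1 - δ / 2 - δ ^ 2 / 8 with hτ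
  have hδ2 : 0 < δ ^ 2 := by positivity
  have hδ21 : δ ^ 2 ≤ δ := by nlinarith
  have hlog1 : ∀ᶠ n : ℕ in Filter.atTop, 1 ≤ Real.log n :=
    (Real.tendsto_log_atTop.comp tendsto_natCast_atTop_atTop).eventually_ge_atTop 1
  have hge1 : ∀ {n : ℕ} {a : ℝ}, 1 ≤ n → 0 ≤ a → 1 ≤ (n : ℝ) ^ a := fun hn ha =>
    Real.one_le_rpow (by exact_mod_cast hn) ha
  refine ⟨fun n => centerLCA n ((n : ℝ) ^ τ) firstNbrTest,
    fun n => centerLCA n ((n : ℝ) ^ τ) (cheaperTest δ n), fun n => (n : ℝ) ^ (1 - δ ^ 2 / 8),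
    isLittleO_rpow_natCast (by linarith), ?_, ?_, ?_⟩
  · filter_upwards [hlog1, Filter.eventually_ge_atTop 5,
      eventually_mul_rpow_mul_log_le 2 (a := 0) (b := τ) (by rw [hτ]; linarith),
      -- The right side is `p * T`; 32 is the 16 of the growth lemma, doubled because only `|C| ≥ T
      -- / 2` is used.
      eventually_mul_rpow_mul_log_le 32 (a := δ / 2 - δ ^ 2 / 6) (b := δ / 2 - δ ^ 2 / 8)
        (by linarith),
      eventually_mul_rpow_mul_log_le 8 (a := 1 - δ ^ 2 / 4) (b := 1 - δ ^ 2 / 8) (by linarith),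
      eventually_mul_rpow_mul_log_le 4 (a := 0) (b := 1 - δ ^ 2 / 8) (by linarith),
      eventually_mul_rpow_mul_log_le 4 (a := 0) (b := δ) hδ0,
      eventually_mul_rpow_mul_log_le 5 (a := 1 - δ) (b := τ) (by rw [hτ]; linarith)]
      with n hlog hn hT2 hexpand hfew hf hdeg hlow
    rw [Real.rpow_zero, mul_one] at hT2 hf hdeg
    have hn1 : 1 ≤ n := by omega
    have hn1' : (1 : ℝ) ≤ n := by exact_mod_cast hn1
    have hn0 : (0 : ℝ) < n := by linarith
    have hpn : (p n : ℝ) = (n : ℝ) ^ (δ - 1) := by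
      rw [Real.rpow_sub_one hn0.ne', ← hp n]; field_simp
    set T : ℝ := (n : ℝ) ^ τ with hTdef
    have hTn : T ≤ n := by
      calc T ≤ (n : ℝ) ^ (1 : ℝ) := Real.rpow_le_rpow_of_exponent_le hn1' (by rw [hτ]; linarith)
        _ = n := Real.rpow_one _
    obtain ⟨C, hC, hCT, hTC⟩ := exists_center_finset (n := n) (T := T) (by linarith) hTn
    have hCT2 : T / 2 ≤ C.card := by linarith
    have hp0 : 0 ≤ (p n : ℝ) := (p n).2.1
    have hpT : (p n : ℝ) * T = (n : ℝ) ^ (δ / 2 - δ ^ 2 / 8) := by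
      rw [hpn, hTdef, ← Real.rpow_add hn0, hτ]; ring_nf
    set lam : ℝ := (n : ℝ) ^ (δ / 2 - δ ^ 2 / 6) with hlamdef
    have hlam1 : 1 ≤ lam := hge1 hn1 (by linarith)
    have hlam : 16 * Real.log n * lam ≤ p n * C.card := by
      have : (p n : ℝ) * (T / 2) ≤ p n * C.card := by gcongr
      linarith
    -- Since `j ≥ 2/δ + 1`, the exponent of `lam ^ j` is at least `1 + δ/6 - δ²/6 ≥ 1`, so `lam ^ j
    -- ≥ n`; and `j + 3 ≤ 2/δ + 5`.
    set j : ℕ := ⌊2 / δ⌋₊ + 2 with hj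
    have hfl := Nat.lt_floor_add_one (2 / δ)
    have hfl' := Nat.floor_le (a := 2 / δ) (by positivity)
    have hjC : (C.card : ℝ) ≤ lam ^ j := by
      refine hCT.trans (hTn.trans ?_)
      rw [hlamdef, ← Real.rpow_natCast, ← Real.rpow_mul hn0.le]
      calc (n : ℝ) = (n : ℝ) ^ (1 : ℝ) := (Real.rpow_one _).symm
        _ ≤ _ := by
          refine Real.rpow_le_rpow_of_exponent_le hn1' ?_
          have e1 : 2 / δ + 1 ≤ (j : ℝ) := by rw [hj]; push_cast; linarith
          have e2 : (δ / 2 - δ ^ 2 / 6) * (2 / δ + 1) ≤ (δ / 2 - δ ^ 2 / 6) * j :=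
            mul_le_mul_of_nonneg_left e1 (by linarith)
          have e3 : (δ / 2 - δ ^ 2 / 6) * (2 / δ + 1) = 1 + δ / 6 - δ ^ 2 / 6 := by
            field_simp; ring
          linarith
    set x : ℝ := (n : ℝ) ^ (1 - δ) * Real.log n with hx
    have hx1 : 1 ≤ x := by
      have := hge1 hn1 (show 0 ≤ 1 - δ by linarith)
      rw [hx]; nlinarith
    have hMT : (⌈4 * x⌉₊ : ℝ) ≤ T := by
      have := Nat.ceil_lt_add_one (a := 4 * x) (by linarith)
      linarith
    -- Hence the first `⌈4x⌉` vertices, all of them centers, miss a given non-center with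
    -- probability at most `n⁻⁴`.
    have hpx : (p n : ℝ) * x = Real.log n := by
      rw [hx, ← mul_assoc, hpn, ← Real.rpow_add hn0]
      simp
    refine (binomialRandom_typical_ge hn (p n) C j ⌈8 * (n : ℝ) ^ δ⌉₊ ⌈4 * x⌉₊
      ((n : ℝ) ^ (1 - δ ^ 2 / 8)) ?_ ?_ hf ?_ ?_ ?_ ?_ ?_).trans
      (MeasureTheory.measureReal_mono ?_ (MeasureTheory.measure_ne_top _ _))
    · nlinarith
    · have e1 : (C.card : ℝ) ^ 2 * p n ≤ T ^ 2 * p n := by gcongr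
      have e2 : T ^ 2 * p n = (n : ℝ) ^ (1 - δ ^ 2 / 4) := by
        rw [sq, mul_assoc, mul_comm T (p n : ℝ), hpT, hTdef, ← Real.rpow_add hn0, hτ]
        ring_nf
      have e3 : 0 ≤ (n : ℝ) ^ (1 - δ ^ 2 / 4) := by positivity
      nlinarith
    · rw [hp n]; exact Nat.le_ceil _
    · refine le_trans ?_ (Nat.le_ceil _)
      have : 0 ≤ (n : ℝ) ^ δ := by positivity
      linarith
    · exact_mod_cast hMT.trans hTn
    · have : (p n : ℝ) * (4 * x) ≤ p n * ⌈4 * x⌉₊ := by gcongr; exact Nat.le_ceil _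
      linarith
    · intro v hv
      rw [hC]
      have : ((v : ℕ) : ℝ) + 1 ≤ ⌈4 * x⌉₊ := by exact_mod_cast hv
      exact this.trans hMT
    · intro G hG
      refine ⟨_, rfl, hG.isSpanner hC hp0 (by linarith) hlam1 hlam hjC ?_, ?_, fun L hL => ?_,
        fun L => ?_⟩
      · rw [hj]; push_cast; linarith
      · have h1 : ((centerSubgraph G T).edgeSet.ncard : ℝ) ≤
            n + (G.edgeSet ∩ centerPairs C).ncard := by
          exact_mod_cast ncard_edgeSet_centerSubgraph_le hC
        linarith [hG.center_edges]
      · exact centerLCA_givesAccess fun u v _ _ => firstNbrTest_output hL u v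
      · exact centerLCA_givesAccess fun u v hu _ =>
          cheaperTest_output hG L (fun h => hu ((hC u).1 h)) v
  · intro n G L _ u v
    exact centerLCA_expectedProbes_le le_rfl (fun u v => by simp [firstNbrTest, ProbeTree.probes])
      u v
  · filter_upwards [hlog1, Filter.eventually_ge_atTop 1] with n hlog hn G L u v
    have h₁ : 1 ≤ (n : ℝ) ^ δ := hge1 hn hδ0.le
    have h₂ : 1 ≤ (n : ℝ) ^ (1 - δ) * Real.log n :=
      one_le_mul_of_one_le_of_one_le (hge1 hn (by linarith)) hlog
    exact centerLCA_expectedProbes_le (by linarith [le_min h₁ h₂])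
      (fun u v => cheaperTest_probes_le h₁ h₂ L u v) u v
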